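/- Let $Q$ be a non-degenerate quadratic form of signature $(p,q)$ on a real vector space $V$ of dimension $n=p+q$, i.e. $V\simeq\mathbb{R}^{p,q}$, with associated bilinear form $B$, and let $e_1,\dots,e_n$ be an orthogonal basis with $Q(e_j)=1$ for $j\le p$ and $Q(e_j)=-1$ for $j>p$. Let $\mathrm{Cl}(V)$ be the universal Clifford algebra with the convention $v^2=-Q(v)$, let $a\mapsto\tilde a$ be its reversal and $a\mapsto\hat a$ its grade involution, and let $$\Gamma(V)=\{a\in \mathrm{Cl}(V)^\times : a x \hat a^{-1}\in V \text{ for all } x\in V\}$$ be the Lipschitz group. Identify $\mathrm{Cl}(V\oplus\mathbb{R}^{1,1})$, where $\hat Q(v+x_-e_-+x_+e_+)=Q(v)-x_-^2+x_+^2$, with $\mathrm{Mat}(2,\mathrm{Cl}(V))$ through the algebra isomorphism extending $$v+x_-e_-+x_+e_+\mapsto\begin{pmatrix} v & x_--x_+\\ x_-+x_+ & -v\end{pmatrix}.$$ A Vahlen matrix is an element $A=\begin{pmatrix} a&b\\c&d\end{pmatrix}$ of $\Gamma(V\oplus\mathbb{R}^{1,1})\subset \mathrm{Mat}(2,\mathrm{Cl}(V))$.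 The Dirac operator acts from the left on differentiable functions $f$ with values in a left $\mathrm{Cl}(V)$-module, and from the right on differentiable functions $g$ with values in a right $\mathrm{Cl}(V)$-module, by $$Df=\sum_{j\le p}e_j\,\partial_jf-\sum_{j>p}e_j\,\partial_jf,\qquad gD=\sum_{j\le p}\partial_jg\,e_j-\sum_{j>p}\partial_jg\,e_j .$$ Here the modules are normed real vector spaces on which every element of $\mathrm{Cl}(V)$ acts by a continuous real-linear map (continuity is automatic in finite dimension), the real scalars of $\mathrm{Cl}(V)$ acting as the real scalars of the vector space. A differentiable function on an open subset of $V$ is left (right) monogenic if $Df=0$ ($gD=0$) there. Let $A=\begin{pmatrix} a&b\\c&d\end{pmatrix}$ be a Vahlen matrix. Then $\Delta(A)=a\tilde d-b\tilde c$ is a non-zero real number, and for every $x\in V$ such that $cx+d$ is invertible, $Ax=(ax+b)(cx+d)^{-1}$ lies in $V$ and $(x\tilde c+\tilde d)(cx+d)$ is a non-zero real number. For such $x$ put $$\Omega_A(x)=\frac{\Delta(A)}{(x\tilde c+\tilde d)(cx+d)},\quad J_A(x)=\frac{(cx+d)^{-1}}{|(x\tilde c+\tilde d)(cx+d)|^{n/2-1}},\quad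 \widetilde{J_A}(x)=\frac{(x\tilde c+\tilde d)^{-1}}{|(x\tilde c+\tilde d)(cx+d)|^{n/2-1}} .$$ Let $U\subseteq V$ be open, and let $A^{-1}(U)$ be the set of all $x\in V$ such that $cx+d$ is invertible and $Ax\in U$. (1) Let $\mathcal M$ be a left $\mathrm{Cl}(V)$-module and $f:U\to\mathcal M$ a differentiable function. Then $x\mapsto J_A(x)f(Ax)$ is differentiable at every point of $A^{-1}(U)$, and $$D\bigl(J_A(x)f(Ax)\bigr)=\Omega_A(x)\,J_A(x)\,(Df)(Ax)\qquad\text{for all } x\in A^{-1}(U).$$ In particular, if $f$ is left monogenic on $U$, then $J_A(x)f(Ax)$ is left monogenic on the set $A^{-1}(U)$, which is open. (2) Let $\mathcal M'$ be a right $\mathrm{Cl}(V)$-module and $g:U\to\mathcal M'$ a differentiable function. Then $x\mapsto g(Ax)\widetilde{J_A}(x)$ is differentiable at every point of $A^{-1}(U)$, and $$\bigl(g(Ax)\widetilde{J_A}(x)\bigr)D=\Omega_A(x)\,(gD)(Ax)\,\widetilde{J_A}(x)\qquad\text{for all } x\in A^{-1}(U).$$ In particular, if $g$ is right monogenic on $U$,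 then $g(Ax)\widetilde{J_A}(x)$ is right monogenic on $A^{-1}(U)$. -/

import Mathlib

noncomputable section

namespace Vahlen

open CliffordAlgebra

section Algebra

variable {V : Type*} [AddCommGroup V] [Module ℝ V]

/-- The universal Clifford algebra of `(V, Q)` with the sign convention `v * v = - Q v`. -/
abbrev Cl (Q : QuadraticForm ℝ V) : Type _ := CliffordAlgebra (-Q)

/-- The inclusion of `V` into its Clifford algebra. -/
abbrev vec (Q : QuadraticForm ℝ V) : V →ₗ[ℝ] Cl Q := CliffordAlgebra.ι (-Q)

/-- The Lipschitz group: the invertible elements `a` of the Clifford algebra such that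
`a x â⁻¹` is a vector for every vector `x`, where `â` is the grade involution of `a`. -/
def lipschitz (Q : QuadraticForm ℝ V) : Set (Cl Q) :=
  {a | IsUnit a ∧ ∀ x : V, ∃ y : V, a * vec Q x * Ring.inverse (involute a) = vec Q y}

/-- The quadratic form `Q v - (x₋)² + (x₊)²` on `V ⊕ ℝ^{1,1}`; the triple `(v, x₋, x₊)` stands
for `v + x₋ e₋ + x₊ e₊`. -/
def hatQ (Q : QuadraticForm ℝ V) : QuadraticForm ℝ (V × ℝ × ℝ) :=
  QuadraticMap.prod Q (QuadraticMap.prod (-QuadraticMap.sq) QuadraticMap.sq)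

theorem hatQ_apply (Q : QuadraticForm ℝ V) (x : V × ℝ × ℝ) :
    hatQ Q x = Q x.1 - x.2.1 ^ 2 + x.2.2 ^ 2 := by
  simp [hatQ, QuadraticMap.prod_apply, QuadraticMap.sq_apply]
  ring

/-- The linear map `v + x₋ e₋ + x₊ e₊ ↦ (v, x₋ - x₊; x₋ + x₊, -v)`. -/
def matVec (Q : QuadraticForm ℝ V) :
    (V × ℝ × ℝ) →ₗ[ℝ] Matrix (Fin 2) (Fin 2) (Cl Q) where
  toFun x := !![vec Q x.1, algebraMap ℝ (Cl Q) (x.2.1 - x.2.2);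
    algebraMap ℝ (Cl Q) (x.2.1 + x.2.2), -vec Q x.1]
  map_add' x y := by
    ext i j
    fin_cases i <;> fin_cases j <;> simp <;> abel
  map_smul' r x := by
    ext i j
    fin_cases i <;> fin_cases j <;>
      simp [Algebra.smul_def, mul_sub, mul_add]

theorem matVec_mul_self (Q : QuadraticForm ℝ V) (x : V × ℝ × ℝ) :
    matVec Q x * matVec Q x =
      algebraMap ℝ (Matrix (Fin 2) (Fin 2) (Cl Q)) ((-hatQ Q) x) := by
  have h : vec Q x.1 * vec Q x.1 = algebraMap ℝ (Cl Q) (-(Q x.1)) := by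
    rw [CliffordAlgebra.ι_sq_scalar]; rfl
  have hc : ∀ r : ℝ, algebraMap ℝ (Cl Q) r * vec Q x.1 = vec Q x.1 * algebraMap ℝ (Cl Q) r :=
    fun r => Algebra.commutes r _
  ext i j
  rw [Matrix.algebraMap_matrix_apply, neg_apply, hatQ_apply]
  fin_cases i <;> fin_cases j
  · simp only [matVec, LinearMap.coe_mk, AddHom.coe_mk, Matrix.mul_apply, Fin.sum_univ_two]
    simp [-map_sub, -map_add, -map_neg, -ι_sq_scalar, h, ← map_mul, ← map_add]
    ring_nf
  · simp only [matVec, LinearMap.coe_mk, AddHom.coe_mk, Matrix.mul_apply, Fin.sum_univ_two]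
    simp [-map_sub, -map_add, hc]
  · simp only [matVec, LinearMap.coe_mk, AddHom.coe_mk, Matrix.mul_apply, Fin.sum_univ_two]
    simp [-map_sub, -map_add, hc]
  · simp only [matVec, LinearMap.coe_mk, AddHom.coe_mk, Matrix.mul_apply, Fin.sum_univ_two]
    simp [-map_sub, -map_add, -map_neg, -ι_sq_scalar, h, ← map_mul, ← map_add]
    ring_nf

/-- The algebra map `Cl(V ⊕ ℝ^{1,1}) → Mat(2, Cl(V))` that extends `matVec`; it is the usual
isomorphism through which the two algebras are identified. -/
def matHom (Q : QuadraticForm ℝ V) :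
    Cl (hatQ Q) →ₐ[ℝ] Matrix (Fin 2) (Fin 2) (Cl Q) :=
  CliffordAlgebra.lift (-hatQ Q) ⟨matVec Q, matVec_mul_self Q⟩

/-- A Vahlen matrix: a matrix that belongs to the Lipschitz group of `V ⊕ ℝ^{1,1}`. -/
def IsVahlen {Q : QuadraticForm ℝ V} (A : Matrix (Fin 2) (Fin 2) (Cl Q)) : Prop :=
  ∃ α ∈ lipschitz (hatQ Q), matHom Q α = A

/-- The real number `r` with `a = r • 1`, for an element `a` of the line `ℝ • 1`
(a junk value for other elements). -/
def toReal {Q : QuadraticForm ℝ V} (a : Cl Q) : ℝ := Function.invFun (algebraMap ℝ (Cl Q)) a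

/-- The vector `v` with `a = v` in the Clifford algebra, for an element `a` of the image of `V`
(a junk value for other elements). -/
def toVec {Q : QuadraticForm ℝ V} (a : Cl Q) : V := Function.invFun (vec Q) a

variable {Q : QuadraticForm ℝ V} (A : Matrix (Fin 2) (Fin 2) (Cl Q))

/-- `c x + d`. -/
def den (x : V) : Cl Q := A 1 0 * vec Q x + A 1 1

/-- `x c̃ + d̃`, the tilde being the reversal. -/
def denRev (x : V) : Cl Q := vec Q x * reverse (A 1 0) + reverse (A 1 1)

/-- `(a x + b) (c x + d)⁻¹` as an element of the Clifford algebra. -/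
def actCl (x : V) : Cl Q := (A 0 0 * vec Q x + A 0 1) * Ring.inverse (den A x)

/-- The vector `A x = (a x + b) (c x + d)⁻¹`. -/
def act (x : V) : V := toVec (actCl A x)

/-- The pseudo-determinant `a d̃ - b c̃` as an element of the Clifford algebra. -/
def pdetCl : Cl Q := A 0 0 * reverse (A 1 1) - A 0 1 * reverse (A 1 0)

/-- The pseudo-determinant `Δ(A) = a d̃ - b c̃` as a real number. -/
def pdet : ℝ := toReal (pdetCl A)

/-- `(x c̃ + d̃) (c x + d)` as a real number. -/
def nrm (x : V) : ℝ := toReal (denRev A x * den A x)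

/-- The conformal factor `Ω_A(x) = Δ(A) / ((x c̃ + d̃) (c x + d))`. -/
def Omega (x : V) : ℝ := pdet A / nrm A x

/-- `J_A(x) = (c x + d)⁻¹ / |(x c̃ + d̃) (c x + d)| ^ (n / 2 - 1)` with `n = dim V`. -/
def J (x : V) : Cl Q :=
  (|nrm A x| ^ ((Module.finrank ℝ V : ℝ) / 2 - 1))⁻¹ • Ring.inverse (den A x)

/-- The reversed factor `(x c̃ + d̃)⁻¹ / |(x c̃ + d̃) (c x + d)| ^ (n / 2 - 1)`. -/
def JRev (x : V) : Cl Q :=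
  (|nrm A x| ^ ((Module.finrank ℝ V : ℝ) / 2 - 1))⁻¹ • Ring.inverse (denRev A x)

/-- `A⁻¹(U)`: the points `x` at which `c x + d` is invertible and `A x ∈ U`. -/
def preimage (U : Set V) : Set V := {x | IsUnit (den A x) ∧ act A x ∈ U}

/-- An orthogonal basis of `V` whose first `p` vectors have `Q = 1` and whose last `q` vectors
have `Q = -1`; thus `(V, Q)` is `ℝ^{p,q}`. -/
structure IsPseudoOrthonormal (Q : QuadraticForm ℝ V) {p q : ℕ}
    (e : Module.Basis (Fin p ⊕ Fin q) ℝ V) : Prop where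
  pos : ∀ i, Q (e (Sum.inl i)) = 1
  neg : ∀ j, Q (e (Sum.inr j)) = -1
  ortho : ∀ i j, i ≠ j → QuadraticMap.polar Q (e i) (e j) = 0

end Algebra

section Analysis

variable {V : Type*} [NormedAddCommGroup V] [NormedSpace ℝ V] (Q : QuadraticForm ℝ V)
  {p q : ℕ} (e : Module.Basis (Fin p ⊕ Fin q) ℝ V)

/-- The Dirac operator acting from the left,
`D f = e₁ ∂₁f + ⋯ + e_p ∂_p f - e_{p+1} ∂_{p+1} f - ⋯ - e_{p+q} ∂_{p+q} f`. -/
def diracL {M : Type*} [NormedAddCommGroup M] [NormedSpace ℝ M] [Module (Cl Q) M]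
    (f : V → M) (x : V) : M :=
  ∑ i : Fin p, vec Q (e (Sum.inl i)) • fderiv ℝ f x (e (Sum.inl i))
    - ∑ j : Fin q, vec Q (e (Sum.inr j)) • fderiv ℝ f x (e (Sum.inr j))

/-- The Dirac operator acting from the right on functions with values in a right module,
`g D = ∂₁g e₁ + ⋯ + ∂_p g e_p - ∂_{p+1} g e_{p+1} - ⋯ - ∂_{p+q} g e_{p+q}`. -/
def diracR {M : Type*} [NormedAddCommGroup M] [NormedSpace ℝ M] [Module (Cl Q)ᵐᵒᵖ M]
    (g : V → M) (x : V) : M :=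
  ∑ i : Fin p, MulOpposite.op (vec Q (e (Sum.inl i))) • fderiv ℝ g x (e (Sum.inl i))
    - ∑ j : Fin q, MulOpposite.op (vec Q (e (Sum.inr j))) • fderiv ℝ g x (e (Sum.inr j))

/-- `f` is left monogenic on the open set `U`. -/
structure IsLeftMonogenicOn {M : Type*} [NormedAddCommGroup M] [NormedSpace ℝ M]
    [Module (Cl Q) M] (f : V → M) (U : Set V) : Prop where
  isOpen : IsOpen U
  differentiableAt : ∀ x ∈ U, DifferentiableAt ℝ f x
  dirac_eq_zero : ∀ x ∈ U, diracL Q e f x = 0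

/-- `g` is right monogenic on the open set `U`. -/
structure IsRightMonogenicOn {M : Type*} [NormedAddCommGroup M] [NormedSpace ℝ M]
    [Module (Cl Q)ᵐᵒᵖ M] (g : V → M) (U : Set V) : Prop where
  isOpen : IsOpen U
  differentiableAt : ∀ x ∈ U, DifferentiableAt ℝ g x
  dirac_eq_zero : ∀ x ∈ U, diracR Q e g x = 0

end Analysis

end Vahlen

end

/-! Write N = (xc̃ + d̃)(cx + d), y = Ax, s = n/2. On all of V, (cx + d)⁻¹ = N⁻¹(xc̃ + d̃) (both
sides read as 0 where N = 0), so J_A is a scalar function of N, homogeneous of degree -s, times the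
affine function xc̃ + d̃. The product rule splits D(J_A · f(Ax)) into three sums. Differentiating
xc̃ + d̃ gives a multiple of ∑ Q(eᵢ)eᵢ² = -n, and differentiating the scalar gives the opposite
multiple of c̃; these two cancel, which is what fixes the exponent n/2 - 1. In the third sum the
derivative of x ↦ Ax is φ(h) = (Δ/N²)(cx + d)h(xc̃ + d̃), a similarity multiplying Q by Ω²
(`polar_of_vec_eq`). Moving eᵢ past xc̃ + d̃ turns it into Ω⁻¹φ(eᵢ) (`vec_mul_denRev`), and the
tensor ∑ Q(eᵢ) eᵢ ⊗ eᵢ scales by Ω² under φ (`sum_similarity`), leaving the single factor Ω.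

The algebra rests on `lipschitz_properties`: since the twisted centre is scalar, αᾱ is a scalar and
both v ↦ αvᾱ and v ↦ ᾱvα preserve vectors. Reading matrix entries at suitable vectors yields
`VahlenIdentities`; for this `matHom` need only be an algebra map. The right-handed statement
follows from the left-handed one by reversal. -/

namespace Vahlen

open CliffordAlgebra

/-! ### Clifford algebras: the twisted centre and the Lipschitz group. -/

section Clifford

variable {W : Type*} [AddCommGroup W] [Module ℝ W] (q : QuadraticForm ℝ W)

/-- The linear isomorphism with the exterior algebra is the identity on vectors. -/
theorem ι_injective : Function.Injective (ι q) := by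
  let _ : Invertible (2 : ℝ) := invertibleOfNonzero two_ne_zero
  intro a b h
  have h' := congrArg (equivExterior q) h
  have key : ∀ m, equivExterior q (ι q m) = ExteriorAlgebra.ι ℝ m :=
    fun m => changeForm_ι changeForm.associated_neg_proof m
  rw [key, key] at h'
  exact (ExteriorAlgebra.ι_inj ℝ a b).1 h'

instance instNontrivialClifford : Nontrivial (CliffordAlgebra q) :=
  letI : Invertible (2 : ℝ) := invertibleOfNonzero two_ne_zero
  inferInstance

theorem algebraMap_injective : Function.Injective (algebraMap ℝ (CliffordAlgebra q)) :=
  (algebraMap ℝ (CliffordAlgebra q)).injective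

variable {q}

theorem isUnit_algebraMap {r : ℝ} (hr : r ≠ 0) : IsUnit (algebraMap ℝ (CliffordAlgebra q) r) :=
  (IsUnit.mk0 r hr).map _

/-- Elements of the subalgebra generated by vectors orthogonal to `e` twisted-commute with `e`. -/
theorem mul_ι_of_mem_adjoin {s : Set W} {e : W} (h : ∀ v ∈ s, QuadraticMap.polar q v e = 0)
    {u : CliffordAlgebra q} (hu : u ∈ Algebra.adjoin ℝ (ι q '' s)) :
    involute u ∈ Algebra.adjoin ℝ (ι q '' s) ∧ u * ι q e = ι q e * involute u := by
  induction hu using Algebra.adjoin_induction with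
  | mem x hx =>
    obtain ⟨v, hv, rfl⟩ := hx
    refine ⟨by rw [involute_ι]; exact neg_mem (Algebra.subset_adjoin ⟨v, hv, rfl⟩), ?_⟩
    rw [involute_ι, mul_neg, eq_neg_iff_add_eq_zero, ι_mul_ι_add_swap, h v hv, map_zero]
  | algebraMap r => exact ⟨by simp, by simp [Algebra.commutes]⟩
  | add x y _ _ hx hy =>
    exact ⟨by rw [map_add]; exact add_mem hx.1 hy.1, by rw [map_add, add_mul, mul_add, hx.2, hy.2]⟩
  | mul x y _ _ hx hy =>
    exact ⟨by rw [map_mul]; exact mul_mem hx.1 hy.1,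
      by rw [map_mul, mul_assoc, hy.2, ← mul_assoc, hx.2, mul_assoc]⟩

/-- Every `e` can be moved to the left at the cost of a grade involution, and `e` squares to a
scalar, so the sums u + ew are closed under products. -/
theorem exists_eq_add_ι_mul_of_mem_adjoin {s : Set W} {e : W}
    (h : ∀ v ∈ s, QuadraticMap.polar q v e = 0) {x : CliffordAlgebra q}
    (hx : x ∈ Algebra.adjoin ℝ (ι q '' insert e s)) :
    ∃ u ∈ Algebra.adjoin ℝ (ι q '' s), ∃ w ∈ Algebra.adjoin ℝ (ι q '' s),
      x = u + ι q e * w := by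
  induction hx using Algebra.adjoin_induction with
  | mem x hx =>
    obtain ⟨v, rfl | hv, rfl⟩ := hx
    · exact ⟨0, zero_mem _, 1, one_mem _, by simp⟩
    · exact ⟨_, Algebra.subset_adjoin ⟨v, hv, rfl⟩, 0, zero_mem _, by simp⟩
  | algebraMap r => exact ⟨_, algebraMap_mem _ r, 0, zero_mem _, by simp⟩
  | add x y _ _ hx hy =>
    obtain ⟨u, hu, w, hw, rfl⟩ := hx
    obtain ⟨u', hu', w', hw', rfl⟩ := hy
    exact ⟨_, add_mem hu hu', _, add_mem hw hw', by rw [mul_add]; abel⟩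
  | mul x y _ _ hx hy =>
    obtain ⟨u, hu, w, hw, rfl⟩ := hx
    obtain ⟨u', hu', w', hw', rfl⟩ := hy
    obtain ⟨hu₁, hu₂⟩ := mul_ι_of_mem_adjoin h hu
    obtain ⟨hw₁, hw₂⟩ := mul_ι_of_mem_adjoin h hw
    refine ⟨u * u' + algebraMap ℝ _ (q e) * (involute w * w'),
      add_mem (mul_mem hu hu') (mul_mem (algebraMap_mem _ _) (mul_mem hw₁ hw')),
      w * u' + involute u * w', add_mem (mul_mem hw hu') (mul_mem hu₁ hw'), ?_⟩
    have e1 : u * (ι q e * w') = ι q e * (involute u * w') := by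
      rw [← mul_assoc, hu₂, mul_assoc]
    have e2 : ι q e * w * (ι q e * w') = algebraMap ℝ _ (q e) * (involute w * w') := by
      rw [← ι_sq_scalar, mul_assoc, ← mul_assoc w, hw₂]; simp only [mul_assoc]
    rw [add_mul, mul_add, mul_add, e1, e2, mul_add, mul_assoc]
    abel

/-- The twisted centre of the Clifford algebra of a form with a finite orthogonal spanning family
of anisotropic vectors consists of scalars. -/
theorem exists_algebraMap_eq_of_twisted_central {κ : Type*} [Finite κ] {v : κ → W}
    (hspan : Submodule.span ℝ (Set.range v) = ⊤) (hv : ∀ i, q (v i) ≠ 0)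
    (hort : ∀ i j, i ≠ j → QuadraticMap.polar q (v i) (v j) = 0) {N : CliffordAlgebra q}
    (hN : ∀ x, N * ι q x = ι q x * involute N) : ∃ r, algebraMap ℝ _ r = N := by
  classical
  have key : ∀ S : Finset κ, N ∈ Algebra.adjoin ℝ (ι q '' (v '' S)) →
      ∃ r, algebraMap ℝ _ r = N := by
    intro S
    induction S using Finset.induction_on with
    | empty =>
      intro h
      simpa [Algebra.mem_bot] using h
    | insert i S hi ih =>
      intro h
      apply ih
      rw [Finset.coe_insert, Set.image_insert_eq] at h
      have ho : ∀ w ∈ v '' (S : Set κ), QuadraticMap.polar q w (v i) = 0 := by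
        rintro _ ⟨j, hj, rfl⟩
        exact hort j i (by rintro rfl; exact hi hj)
      obtain ⟨u, hu, w, hw, rfl⟩ := exists_eq_add_ι_mul_of_mem_adjoin ho h
      -- With e = `v i`, the two sides are eû + e²ŵ and eû - e²ŵ. Since e² is a nonzero scalar, w =
      -- 0 and one generator has been eliminated.
      have h1 := hN (v i)
      rw [map_add, map_mul, involute_ι, add_mul, mul_add, (mul_ι_of_mem_adjoin ho hu).2,
        mul_assoc, (mul_ι_of_mem_adjoin ho hw).2, add_right_inj, neg_mul, mul_neg,
        ← mul_assoc, ι_sq_scalar, eq_neg_iff_add_eq_zero, ← two_smul ℝ, smul_eq_zero_iff_right two_ne_zero]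
        at h1
      have h2 : involute w = 0 := (isUnit_algebraMap (hv i)).mul_right_eq_zero.1 h1
      have h3 : w = 0 := by simpa using congrArg involute h2
      simpa [h3] using hu
  cases nonempty_fintype κ
  apply key Finset.univ
  have : Algebra.adjoin ℝ (ι q '' (v '' (Finset.univ : Finset κ))) = ⊤ := by
    rw [eq_top_iff, ← adjoin_range_ι, Algebra.adjoin_le_iff]
    rintro _ ⟨w, rfl⟩
    have hw : w ∈ Submodule.span ℝ (Set.range v) := hspan ▸ Submodule.mem_top
    induction hw using Submodule.span_induction with
    | mem x hx => exact Algebra.subset_adjoin ⟨x, by simpa using hx, rfl⟩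
    | zero => simp
    | add x y _ _ hx hy => rw [map_add]; exact add_mem hx hy
    | smul a x _ hx => rw [map_smul]; exact Subalgebra.smul_mem _ hx a
  rw [this]
  exact Algebra.mem_top

theorem involute_reverse (a : CliffordAlgebra q) : involute (reverse a) = reverse (involute a) :=
  (reverse_involute a).symm

/-- Elements of the Lipschitz group are homogeneous, have an invertible scalar norm, and act
on vectors by `x ↦ α x ᾱ` and `x ↦ ᾱ x α`, the bar being the Clifford conjugation. -/
theorem lipschitz_properties [FiniteDimensional ℝ W]
    (hZ : ∀ N : CliffordAlgebra q, (∀ x, N * ι q x = ι q x * involute N) →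
      ∃ r, algebraMap ℝ _ r = N)
    {α : CliffordAlgebra q} (hα : IsUnit α)
    (h : ∀ x, ∃ y, α * ι q x * Ring.inverse (involute α) = ι q y) :
    (∃ r : ℝ, r ≠ 0 ∧ α * reverse (involute α) = algebraMap ℝ _ r ∧
      reverse (involute α) * α = algebraMap ℝ _ r) ∧
    (∀ x, ∃ y, α * ι q x * reverse (involute α) = ι q y) ∧
    (∀ x, ∃ y, reverse (involute α) * ι q x * α = ι q y) := by
  have hα' : IsUnit (involute α) := hα.map _
  have hr' : ∀ {a : CliffordAlgebra q}, IsUnit a → IsUnit (reverse a) := fun {a} ha => by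
    rw [← unop_reverseOp]
    exact (ha.map reverseOp).unop
  choose y hy using h
  have h1 : ∀ x, α * ι q x = ι q (y x) * involute α := fun x => by
    rw [← hy, Ring.inverse_mul_cancel_right _ _ hα']
  have h2 : ∀ x, ι q x * reverse α = reverse (involute α) * ι q (y x) := fun x => by
    simpa using congrArg reverse (h1 x)
  have h3 : ∀ x, ι q x * reverse (involute α) = reverse α * ι q (y x) := fun x => by
    simpa [involute_reverse] using congrArg involute (h2 x)
  -- Both ᾱα and α̃α satisfy the twisted commutation relation, hence are scalars; comparing them
  -- makes α̂ a real multiple of α.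
  obtain ⟨r, hr⟩ := hZ (reverse (involute α) * α) fun x => by
    rw [mul_assoc, h1, ← mul_assoc, ← h2, map_mul, involute_reverse, involute_involute, mul_assoc]
  obtain ⟨s, hs⟩ := hZ (reverse α * α) fun x => by
    rw [mul_assoc, h1, ← mul_assoc, ← h3, map_mul, involute_reverse, mul_assoc]
  have hr0 : r ≠ 0 := by
    rintro rfl
    have := (hr' hα').mul hα
    rw [← hr, map_zero] at this
    exact not_isUnit_zero this
  have hs0 : s ≠ 0 := by
    rintro rfl
    have := (hr' hα).mul hα
    rw [← hs, map_zero] at this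
    exact not_isUnit_zero this
  have hrr : α * reverse (involute α) = algebraMap ℝ _ r := by
    apply hα.mul_right_cancel
    rw [mul_assoc, ← hr, Algebra.commutes]
  have hε : involute α = (r / s) • α := by
    have h4 : reverse (involute α) = (r / s) • reverse α := by
      apply hα.mul_right_cancel
      rw [← hr, smul_mul_assoc, ← hs, Algebra.smul_def, ← map_mul, div_mul_cancel₀ _ hs0]
    simpa using congrArg reverse h4
  have h5 : ∀ x, α * ι q x * reverse (involute α) = ι q ((r / s * r) • y x) := fun x => by
    have h6 : involute α * reverse (involute α) = algebraMap ℝ _ (r / s * r) := by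
      conv_lhs => rw [congrArg (· * reverse (involute α)) hε]
      rw [smul_mul_assoc, hrr, Algebra.smul_def, map_mul]
    rw [h1, mul_assoc, h6, ← Algebra.commutes, ← Algebra.smul_def, map_smul]
  refine ⟨⟨r, hr0, hrr, hr.symm⟩, fun x => ⟨_, h5 x⟩, fun x => ?_⟩
  obtain ⟨T, hT⟩ : ∃ T : W →ₗ[ℝ] W, ∀ x, ι q (T x) = α * ι q x * reverse (involute α) := by
    refine ⟨{ toFun := fun x => (r / s * r) • y x, map_add' := ?_, map_smul' := ?_ }, fun x =>
      (h5 x).symm⟩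
    · intro a b
      apply ι_injective q
      rw [map_add, ← h5, ← h5, ← h5, map_add, mul_add, add_mul]
    · intro c a
      apply ι_injective q
      rw [RingHom.id_apply, map_smul (ι q) c, ← h5, ← h5, map_smul, mul_smul_comm, smul_mul_assoc]
  have hTinj : Function.Injective T := by
    rw [injective_iff_map_eq_zero]
    intro x hx
    have h6 := hT x
    rw [hx, map_zero, eq_comm, (hr' hα').mul_left_eq_zero, hα.mul_right_eq_zero] at h6
    exact ι_injective q (by rw [h6, map_zero])
  -- In finite dimension x = αzᾱ for some z, whence ᾱxα = r²z.
  obtain ⟨z, rfl⟩ := LinearMap.injective_iff_surjective.1 hTinj x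
  refine ⟨(r * r) • z, ?_⟩
  rw [hT, ← mul_assoc, ← mul_assoc, ← hr, mul_assoc, ← hr, map_smul, Algebra.smul_def, mul_assoc,
    ← Algebra.commutes r (ι q z), map_mul, mul_assoc]

end Clifford

/-! ### Identities between the entries of a Vahlen matrix. -/

section Matrix

variable {V : Type*} [AddCommGroup V] [Module ℝ V] {Q : QuadraticForm ℝ V}

theorem vec_mul_self (x : V) : vec Q x * vec Q x = algebraMap ℝ (Cl Q) (-Q x) := by
  rw [CliffordAlgebra.ι_sq_scalar]; rfl

theorem vec_mul_vec_add_swap (x y : V) :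
    vec Q x * vec Q y + vec Q y * vec Q x = algebraMap ℝ (Cl Q) (-QuadraticMap.polar Q x y) := by
  rw [CliffordAlgebra.ι_mul_ι_add_swap, FunLike.coe_neg, QuadraticMap.polar_neg]

theorem toReal_algebraMap (r : ℝ) : toReal (algebraMap ℝ (Cl Q) r) = r :=
  Function.leftInverse_invFun (algebraMap_injective (-Q)) r

theorem toVec_vec (x : V) : toVec (vec Q x) = x :=
  Function.leftInverse_invFun (ι_injective (-Q)) x

theorem matHom_ι (x : V × ℝ × ℝ) : matHom Q (ι (-hatQ Q) x) = matVec Q x :=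
  CliffordAlgebra.lift_ι_apply _ _ x

/-- Clifford conjugation is the anti-automorphism negating vectors; the matrix expression on the
right also reverses products and negates `matVec`. -/
theorem matHom_conj (α : Cl (hatQ Q)) :
    matHom Q (reverse (involute α)) =
      !![reverse (matHom Q α 1 1), -reverse (matHom Q α 0 1);
        -reverse (matHom Q α 1 0), reverse (matHom Q α 0 0)] := by
  induction α using CliffordAlgebra.induction with
  | algebraMap r =>
    ext i j
    fin_cases i <;> fin_cases j <;> simp [Matrix.algebraMap_matrix_apply]
  | ι x =>
    rw [involute_ι, map_neg, reverse_ι, map_neg, matHom_ι]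
    ext i j
    fin_cases i <;> fin_cases j <;> simp [matVec, -map_sub, -map_add]
  | mul a b ha hb =>
    rw [map_mul, reverse.map_mul, map_mul, ha, hb, map_mul, Matrix.mul_fin_two]
    generalize matHom Q a = X
    generalize matHom Q b = Y
    simp only [Matrix.mul_apply, Fin.sum_univ_two, map_add, reverse.map_mul, neg_mul, mul_neg,
      neg_neg, neg_add]
    have hm : ∀ {a b c d a' b' c' d' : Cl Q}, a = a' → b = b' → c = c' → d = d' →
        !![a, b; c, d] = !![a', b'; c', d'] := by rintro _ _ _ _ _ _ _ _ rfl rfl rfl rfl; rfl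
    exact hm (add_comm _ _) (add_comm _ _) (add_comm _ _) (add_comm _ _)
  | add a b ha hb =>
    rw [map_add, map_add, map_add, ha, hb]
    simp only [Matrix.add_apply, map_add, neg_add]
    ext i j
    fin_cases i <;> fin_cases j <;> rfl

theorem polar_hatQ (x y : V × ℝ × ℝ) :
    QuadraticMap.polar (hatQ Q) x y =
      QuadraticMap.polar Q x.1 y.1 - 2 * x.2.1 * y.2.1 + 2 * x.2.2 * y.2.2 := by
  simp only [QuadraticMap.polar, hatQ_apply, Prod.fst_add, Prod.snd_add]
  ring

/-- The twisted centre of `Cl(V ⊕ ℝ^{1,1})` consists of scalars. -/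
theorem twisted_central_hatQ {p q : ℕ} {e : Module.Basis (Fin p ⊕ Fin q) ℝ V}
    (he : IsPseudoOrthonormal Q e) (N : Cl (hatQ Q))
    (hN : ∀ x, N * ι (-hatQ Q) x = ι (-hatQ Q) x * involute N) :
    ∃ r, algebraMap ℝ _ r = N := by
  refine exists_algebraMap_eq_of_twisted_central (q := -hatQ Q)
    (v := Sum.elim (fun i => ((e i, 0, 0) : V × ℝ × ℝ))
      (Sum.elim (fun _ : Unit => (0, 1, 0)) (fun _ : Unit => (0, 0, 1)))) ?_ ?_ ?_ hN
  · rw [eq_top_iff]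
    rintro ⟨v, s, t⟩ -
    have h1 : ∀ v ∈ Submodule.span ℝ (Set.range e), ((v, 0, 0) : V × ℝ × ℝ) ∈
        Submodule.span ℝ (Set.range (Sum.elim (fun i => ((e i, 0, 0) : V × ℝ × ℝ))
          (Sum.elim (fun _ : Unit => (0, 1, 0)) (fun _ : Unit => (0, 0, 1))))) := by
      intro v hv
      induction hv using Submodule.span_induction with
      | mem x hx =>
        obtain ⟨i, rfl⟩ := hx
        exact Submodule.subset_span ⟨Sum.inl i, rfl⟩
      | zero => exact zero_mem _
      | add x y _ _ hx hy => simpa using add_mem hx hy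
      | smul a x _ hx => simpa using Submodule.smul_mem _ a hx
    have h2 := add_mem (h1 v (by rw [e.span_eq]; exact Submodule.mem_top))
      (add_mem (Submodule.smul_mem _ s (Submodule.subset_span ⟨Sum.inr (Sum.inl ()), rfl⟩))
        (Submodule.smul_mem _ t (Submodule.subset_span ⟨Sum.inr (Sum.inr ()), rfl⟩)))
    simpa using h2
  · rintro ((i | i) | i | i) <;> simp [hatQ_apply, he.pos, he.neg]
  · rintro (i | i | i) (j | j | j) hij <;>
      simp only [FunLike.coe_neg, QuadraticMap.polar_neg, polar_hatQ, Sum.elim_inl, Sum.elim_inr]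
    · rw [he.ortho i j (by rintro rfl; exact hij rfl)]; simp
    all_goals first | (exact absurd rfl hij) | simp

/-- The algebraic identities satisfied by the entries of a Vahlen matrix. -/
structure VahlenIdentities (A : Matrix (Fin 2) (Fin 2) (Cl Q)) (r κ δ : ℝ) (g : V) : Prop where
  ne_zero : r ≠ 0
  pdetCl_eq : pdetCl A = algebraMap ℝ _ r
  rev_sub : reverse (A 1 1) * A 0 0 - reverse (A 0 1) * A 1 0 = algebraMap ℝ _ r
  rev_comm : reverse (A 1 0) * A 0 0 = reverse (A 0 0) * A 1 0
  rev_c_mul_c : reverse (A 1 0) * A 1 0 = algebraMap ℝ _ κ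
  rev_d_mul_d : reverse (A 1 1) * A 1 1 = algebraMap ℝ _ δ
  rev_c_mul_d : reverse (A 1 0) * A 1 1 = vec Q g
  rev_d_mul_c : reverse (A 1 1) * A 1 0 = vec Q g
  num_mul_denRev : ∀ x, ∃ w, (A 0 0 * vec Q x + A 0 1) * denRev A x = vec Q w
  den_mul_denRev : ∀ x, ∃ t : ℝ, den A x * denRev A x = algebraMap ℝ _ t

theorem IsVahlen.exists_identities {p q : ℕ} {e : Module.Basis (Fin p ⊕ Fin q) ℝ V}
    (he : IsPseudoOrthonormal Q e) {A : Matrix (Fin 2) (Fin 2) (Cl Q)} (hA : IsVahlen A) :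
    ∃ r κ δ g, VahlenIdentities A r κ δ g := by
  suffices H :
      (∃ r : ℝ, r ≠ 0 ∧ pdetCl A = algebraMap ℝ _ r ∧
        reverse (A 1 1) * A 0 0 - reverse (A 0 1) * A 1 0 = algebraMap ℝ _ r ∧
        reverse (A 1 0) * A 0 0 = reverse (A 0 0) * A 1 0) ∧
      (∃ (κ δ : ℝ) (g : V), reverse (A 1 0) * A 1 0 = algebraMap ℝ _ κ ∧
        reverse (A 1 1) * A 1 1 = algebraMap ℝ _ δ ∧
        reverse (A 1 0) * A 1 1 = vec Q g ∧ reverse (A 1 1) * A 1 0 = vec Q g) ∧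
      ∀ x, (∃ w, (A 0 0 * vec Q x + A 0 1) * denRev A x = vec Q w) ∧
        ∃ t : ℝ, den A x * denRev A x = algebraMap ℝ _ t by
    obtain ⟨⟨r, h1, h2, h3, h4⟩, ⟨κ, δ, g, h5, h6, h7, h8⟩, h9⟩ := H
    exact ⟨r, κ, δ, g, h1, h2, h3, h4, h5, h6, h7, h8, fun x => (h9 x).1, fun x => (h9 x).2⟩
  obtain ⟨α, ⟨hu, hα⟩, rfl⟩ := hA
  have : FiniteDimensional ℝ V := Module.Basis.finiteDimensional_of_finite e
  obtain ⟨⟨r, hr0, hr1, hr2⟩, h1, h2⟩ :=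
    lipschitz_properties (twisted_central_hatQ he) hu hα
  set A := matHom Q α with hAdef
  have hentry : ∀ {X Y : Matrix (Fin 2) (Fin 2) (Cl Q)}, X = Y → ∀ i j, X i j = Y i j :=
    fun h i j => by rw [h]
  refine ⟨⟨r, hr0, ?_⟩, ?_, fun x => ?_⟩
  · have hr1' := congrArg (matHom Q) hr1
    have hr2' := congrArg (matHom Q) hr2
    rw [map_mul, matHom_conj, AlgHom.commutes] at hr1' hr2'
    have k1 := hentry hr1' 0 0
    have k2 := hentry hr2' 0 0
    have k3 := hentry hr2' 1 0
    simp [Matrix.mul_apply, Fin.sum_univ_two, Matrix.algebraMap_matrix_apply, ← hAdef] at k1 k2 k3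
    refine ⟨?_, ?_, ?_⟩
    · rw [← k1, pdetCl, sub_eq_add_neg]
    · rw [← k2, sub_eq_add_neg]
    · rw [← sub_eq_zero, ← neg_eq_zero, ← k3]; abel
  -- The matrix of this null vector is the elementary matrix E₁₂, so the entries of ᾱE₁₂α are d̃c,
  -- d̃d, -c̃c and -c̃d.
  · obtain ⟨y, hy⟩ := h2 (0, 1 / 2, -1 / 2)
    have hy' := congrArg (matHom Q) hy
    rw [map_mul, map_mul, matHom_conj, matHom_ι, matHom_ι, ← hAdef] at hy'
    have k1 := hentry hy' 0 0
    have k2 := hentry hy' 0 1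
    have k3 := hentry hy' 1 0
    have k4 := hentry hy' 1 1
    have t1 : algebraMap ℝ (Cl Q) (1 / 2 - -1 / 2) = 1 := by norm_num
    have t2 : algebraMap ℝ (Cl Q) (1 / 2 + -1 / 2) = 0 := by norm_num
    simp only [matVec, LinearMap.coe_mk, AddHom.coe_mk, Matrix.mul_apply, Fin.sum_univ_two, t1,
      t2, map_zero] at k1 k2 k3 k4
    simp [-map_sub, -map_add] at k1 k2 k3 k4
    refine ⟨-(y.2.1 + y.2.2), y.2.1 - y.2.2, y.1, ?_, k2, ?_, k1⟩
    · rw [map_neg, ← k3, neg_neg]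
    · exact k4
  -- The matrix of this null vector is the column (x, 1) times the row (1, -x). Hence the first
  -- column of its image under α consists of (ax + b)(xc̃ + d̃) and (cx + d)(xc̃ + d̃).
  · obtain ⟨y, hy⟩ := h1 (x, (1 + Q x) / 2, (1 - Q x) / 2)
    have hy' := congrArg (matHom Q) hy
    rw [map_mul, map_mul, matHom_conj, matHom_ι, matHom_ι, ← hAdef] at hy'
    have k1 := hentry hy' 0 0
    have k3 := hentry hy' 1 0
    have t1 : algebraMap ℝ (Cl Q) ((1 + Q x) / 2 - (1 - Q x) / 2) = -(vec Q x * vec Q x) := by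
      rw [vec_mul_self, ← map_neg]; congr 1; ring
    have t2 : algebraMap ℝ (Cl Q) ((1 + Q x) / 2 + (1 - Q x) / 2) = 1 := by
      rw [← map_one (algebraMap ℝ (Cl Q))]; congr 1; ring
    simp only [matVec, LinearMap.coe_mk, AddHom.coe_mk, Matrix.mul_apply, Fin.sum_univ_two, t1,
      t2] at k1 k3
    simp [-map_sub, -map_add, -ι_sq_scalar] at k1 k3
    refine ⟨⟨y.1, ?_⟩, y.2.1 + y.2.2, ?_⟩
    · rw [← k1, denRev]; noncomm_ring
    · rw [← k3, den, denRev]; noncomm_ring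

end Matrix

/-! ### Pointwise algebra of the Möbius action. -/

section Pointwise

variable {V : Type*} [AddCommGroup V] [Module ℝ V] {Q : QuadraticForm ℝ V}
  {A : Matrix (Fin 2) (Fin 2) (Cl Q)} {r κ δ : ℝ} {g x : V}

theorem reverse_den (A : Matrix (Fin 2) (Fin 2) (Cl Q)) (x : V) :
    reverse (den A x) = denRev A x := by
  simp [den, denRev]

theorem isUnit_reverse {a : Cl Q} (ha : IsUnit a) : IsUnit (reverse a) := by
  rw [← unop_reverseOp]
  exact (ha.map reverseOp).unop

namespace VahlenIdentities

variable (H : VahlenIdentities A r κ δ g)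
include H

theorem pdet_eq : pdet A = r := by
  rw [pdet, H.pdetCl_eq, toReal_algebraMap]

theorem rev_c_mul_den (x : V) : reverse (A 1 0) * den A x = vec Q (κ • x + g) := by
  rw [den, mul_add, ← mul_assoc, H.rev_c_mul_c, H.rev_c_mul_d, map_add, map_smul,
    Algebra.smul_def]

theorem denRev_mul_c (x : V) : denRev A x * A 1 0 = vec Q (κ • x + g) := by
  simpa [reverse_den] using congrArg reverse (H.rev_c_mul_den x)

/-- Expanding the product leaves a real quadratic polynomial in x: the linear terms combine to xg +
gx, which is scalar. Invertibility of cx + d plays no role. -/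
theorem algebraMap_nrm (x : V) : algebraMap ℝ (Cl Q) (nrm A x) = denRev A x * den A x := by
  suffices h : denRev A x * den A x =
      algebraMap ℝ (Cl Q) (-(κ * Q x) - QuadraticMap.polar Q x g + δ) by
    rw [nrm, h, toReal_algebraMap]
  rw [denRev, add_mul, mul_assoc, H.rev_c_mul_den, den, mul_add, ← mul_assoc, H.rev_d_mul_c,
    H.rev_d_mul_d, map_add, map_add, map_smul, mul_add, mul_smul_comm, vec_mul_self,
    add_assoc, ← add_assoc (vec Q x * vec Q g), vec_mul_vec_add_swap, Algebra.smul_def,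
    ← map_mul, ← map_add, ← map_add, ← map_add]
  congr 1
  ring

theorem nrm_ne_zero (hx : IsUnit (den A x)) : nrm A x ≠ 0 := by
  intro h
  have h1 := (isUnit_reverse hx).mul hx
  rw [reverse_den, ← H.algebraMap_nrm, h, map_zero] at h1
  exact not_isUnit_zero h1

/-- The product in this order is some scalar t; multiplying by cx + d on the right gives t(cx + d) =
N(cx + d), and cx + d ≠ 0. -/
theorem den_mul_denRev_eq (hx : nrm A x ≠ 0) :
    den A x * denRev A x = algebraMap ℝ (Cl Q) (nrm A x) := by
  obtain ⟨t, ht⟩ := H.den_mul_denRev x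
  have h1 : t • den A x = nrm A x • den A x := by
    rw [Algebra.smul_def, ← ht, mul_assoc, ← H.algebraMap_nrm, ← Algebra.commutes,
      Algebra.smul_def]
  have h2 : den A x ≠ 0 := by
    intro h
    have h3 := H.algebraMap_nrm x
    rw [h, mul_zero, ← map_zero (algebraMap ℝ (Cl Q))] at h3
    exact hx (algebraMap_injective _ h3)
  rw [ht, smul_left_injective ℝ h2 h1]

theorem isUnit_den_iff : IsUnit (den A x) ↔ nrm A x ≠ 0 := by
  refine ⟨H.nrm_ne_zero, fun hx => ?_⟩
  refine isUnit_iff_exists.2 ⟨(nrm A x)⁻¹ • denRev A x, ?_, ?_⟩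
  · rw [mul_smul_comm, H.den_mul_denRev_eq hx, Algebra.smul_def, ← map_mul, inv_mul_cancel₀ hx,
      map_one]
  · rw [smul_mul_assoc, ← H.algebraMap_nrm, Algebra.smul_def, ← map_mul, inv_mul_cancel₀ hx,
      map_one]

/-- Valid at singular points too, where `Ring.inverse` and the real inverse are both 0. Functions
can therefore be rewritten globally before being differentiated. -/
theorem inverse_den (x : V) :
    Ring.inverse (den A x) = (nrm A x)⁻¹ • denRev A x := by
  by_cases hx : nrm A x = 0
  · rw [Ring.inverse_non_unit _ (by rw [H.isUnit_den_iff, not_not]; exact hx), hx, inv_zero,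
      zero_smul]
  have hu := H.isUnit_den_iff.2 hx
  apply hu.mul_right_cancel
  rw [Ring.inverse_mul_cancel _ hu, smul_mul_assoc, ← H.algebraMap_nrm, Algebra.smul_def,
    ← map_mul, inv_mul_cancel₀ hx, map_one]

theorem vec_act (x : V) : vec Q (act A x) = actCl A x := by
  obtain ⟨w, hw⟩ := H.num_mul_denRev x
  have h : actCl A x = vec Q ((nrm A x)⁻¹ • w) := by
    rw [actCl, H.inverse_den, mul_smul_comm, hw, map_smul]
  rw [act, h, toVec_vec]

theorem vec_act_mul_den (hx : nrm A x ≠ 0) :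
    vec Q (act A x) * den A x = A 0 0 * vec Q x + A 0 1 := by
  rw [H.vec_act, actCl, Ring.inverse_mul_cancel_right _ _ (H.isUnit_den_iff.2 hx)]

/-- Reversing y(cx + d) = ax + b gives (xc̃ + d̃)(a - yc) = x(c̃a - ãc) + (d̃a - b̃c) = r. The
factor a - yc arises on differentiating Ax. -/
theorem sub_act_mul (hx : nrm A x ≠ 0) :
    nrm A x • (A 0 0 - vec Q (act A x) * A 1 0) = r • den A x := by
  have h1 : denRev A x * vec Q (act A x) = vec Q x * reverse (A 0 0) + reverse (A 0 1) := by
    simpa [reverse_den] using congrArg reverse (H.vec_act_mul_den hx)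
  have h2 : denRev A x * (A 0 0 - vec Q (act A x) * A 1 0) = algebraMap ℝ _ r := by
    rw [mul_sub, ← mul_assoc, h1, ← H.rev_sub, denRev, add_mul, add_mul, mul_assoc, mul_assoc,
      H.rev_comm]
    abel
  rw [Algebra.smul_def, ← H.den_mul_denRev_eq hx, mul_assoc, h2, ← Algebra.commutes,
    Algebra.smul_def]

/-- Both ways of differentiating the scalar `(x c̃ + d̃) (c x + d)` agree. -/
theorem den_polarization (hx : nrm A x ≠ 0) (h : V) :
    A 1 0 * vec Q h * denRev A x + den A x * (vec Q h * reverse (A 1 0)) =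
      algebraMap ℝ _ (-QuadraticMap.polar Q h (κ • x + g)) := by
  -- After scaling by N, both c and c̃ are expressed through the vector κx + g, so the left side
  -- becomes a vector anticommutator between cx + d and xc̃ + d̃.
  have hc : nrm A x • A 1 0 = den A x * vec Q (κ • x + g) := by
    rw [← H.denRev_mul_c, ← mul_assoc, H.den_mul_denRev_eq hx, Algebra.smul_def]
  have hc' : nrm A x • reverse (A 1 0) = vec Q (κ • x + g) * denRev A x := by
    rw [← H.rev_c_mul_den, mul_assoc, H.den_mul_denRev_eq hx, Algebra.smul_def,
      Algebra.commutes]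
  apply smul_right_injective _ hx
  change nrm A x • _ = nrm A x • _
  rw [smul_add, ← smul_mul_assoc, ← smul_mul_assoc, hc, ← mul_smul_comm, ← mul_smul_comm, hc',
    ← vec_mul_vec_add_swap]
  have : den A x * vec Q (κ • x + g) * vec Q h * denRev A x +
      den A x * (vec Q h * (vec Q (κ • x + g) * denRev A x)) =
      den A x * (vec Q h * vec Q (κ • x + g) + vec Q (κ • x + g) * vec Q h) * denRev A x := by
    noncomm_ring
  rw [this, vec_mul_vec_add_swap, ← Algebra.commutes, mul_assoc, H.den_mul_denRev_eq hx,
    ← Algebra.commutes, Algebra.smul_def]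

/-- The expression is the derivative at x, along h, of the quadratic map P(x) = (ax + b)(xc̃ + d̃).
It equals the exact central difference (P(x + h) - P(x - h))/2 of two vectors. -/
theorem num_polarization (x h : V) :
    ∃ w, A 0 0 * vec Q h * denRev A x +
      (A 0 0 * vec Q x + A 0 1) * (vec Q h * reverse (A 1 0)) = vec Q w := by
  obtain ⟨w₁, h₁⟩ := H.num_mul_denRev (x + h)
  obtain ⟨w₂, h₂⟩ := H.num_mul_denRev (x - h)
  refine ⟨(1 / 2 : ℝ) • (w₁ - w₂), ?_⟩
  rw [map_smul, map_sub, ← h₁, ← h₂]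
  apply smul_right_injective _ (two_ne_zero (α := ℝ))
  change (2 : ℝ) • _ = (2 : ℝ) • _
  rw [smul_smul, mul_one_div_cancel two_ne_zero, one_smul, two_smul]
  simp only [denRev, map_add, map_sub]
  noncomm_ring

/-- The inner factor (xc̃ + d̃)(cx + d) = N in φ(v)φ(w) is central, so the anticommutator of v and w
is reproduced up to a scalar. -/
theorem polar_of_vec_eq (hx : nrm A x ≠ 0) {φ : V → V}
    (hφ : ∀ h, vec Q (φ h) = (r / nrm A x ^ 2) • (den A x * vec Q h * denRev A x)) (v w : V) :
    QuadraticMap.polar Q (φ v) (φ w) = Omega A x ^ 2 * QuadraticMap.polar Q v w := by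
  apply neg_injective
  apply algebraMap_injective (-Q)
  have h1 : ∀ v w, vec Q (φ v) * vec Q (φ w) =
      (r ^ 2 / nrm A x ^ 3) • (den A x * (vec Q v * vec Q w) * denRev A x) := fun v w => by
    have h2 : den A x * vec Q v * denRev A x * (den A x * vec Q w * denRev A x) =
        nrm A x • (den A x * (vec Q v * vec Q w) * denRev A x) := by
      rw [← mul_assoc, ← mul_assoc, mul_assoc _ (denRev A x), ← H.algebraMap_nrm,
        ← Algebra.commutes, Algebra.smul_def]
      simp only [mul_assoc]
    rw [hφ, hφ, smul_mul_smul_comm, h2, smul_smul]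
    congr 1
    field_simp
  rw [← vec_mul_vec_add_swap, h1, h1, ← smul_add, ← add_mul, ← mul_add, vec_mul_vec_add_swap,
    ← Algebra.commutes, mul_assoc, H.den_mul_denRev_eq hx, ← map_mul, Algebra.smul_def, ← map_mul]
  congr 1
  rw [Omega, H.pdet_eq]
  field_simp

theorem vec_mul_denRev (hx : nrm A x ≠ 0) {φ : V → V}
    (hφ : ∀ h, vec Q (φ h) = (r / nrm A x ^ 2) • (den A x * vec Q h * denRev A x)) (h : V) :
    vec Q h * denRev A x = (Omega A x)⁻¹ • (denRev A x * vec Q (φ h)) := by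
  rw [hφ, mul_smul_comm, ← mul_assoc, ← mul_assoc, ← H.algebraMap_nrm, mul_assoc,
    ← Algebra.smul_def, smul_smul, smul_smul, Omega, H.pdet_eq]
  have := H.ne_zero
  rw [show (r / nrm A x)⁻¹ * (r / nrm A x ^ 2) * nrm A x = 1 by field_simp, one_smul]

theorem J_eq (x : V) : J A x =
    ((|nrm A x| ^ ((Module.finrank ℝ V : ℝ) / 2 - 1))⁻¹ * (nrm A x)⁻¹) • denRev A x := by
  rw [J, H.inverse_den, smul_smul]

theorem preimage_eq (U : Set V) : preimage A U = {x | nrm A x ≠ 0} ∩ act A ⁻¹' U := by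
  ext x
  simp only [preimage, Set.mem_ofPred_eq, H.isUnit_den_iff]
  rfl

end VahlenIdentities

end Pointwise

/-! ### Sums over a pseudo-orthonormal basis. -/

section Orthonormal

variable {V : Type*} [AddCommGroup V] [Module ℝ V] {Q : QuadraticForm ℝ V} {p q : ℕ}
  {e : Module.Basis (Fin p ⊕ Fin q) ℝ V} (he : IsPseudoOrthonormal Q e)
include he

namespace IsPseudoOrthonormal

theorem sq_eq_one (i : Fin p ⊕ Fin q) : Q (e i) * Q (e i) = 1 := by
  rcases i with i | i <;> simp [he.pos, he.neg]

/-- As Q(eᵢ) = ±1, the vectors Q(eᵢ)eᵢ form the dual basis for half the polar form; hence the factor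
2. -/
theorem sum_polar_smul (v : V) :
    ∑ i, (Q (e i) * QuadraticMap.polar Q (e i) v) • e i = (2 : ℝ) • v := by
  have h : ∀ i, QuadraticMap.polar Q (e i) v = 2 * (e.repr v i * Q (e i)) := fun i => by
    conv_lhs => rw [← e.sum_repr v]
    rw [← QuadraticMap.polarBilin_apply_apply, map_sum, Finset.sum_eq_single i]
    · rw [map_smul, QuadraticMap.polarBilin_apply_apply, QuadraticMap.polar_self, smul_eq_mul,
        nsmul_eq_mul]
      push_cast
      ring
    · intro j _ hj
      rw [map_smul, QuadraticMap.polarBilin_apply_apply, he.ortho i j hj.symm, smul_zero]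
    · simp
  conv_rhs => rw [← e.sum_repr v]
  rw [Finset.smul_sum]
  refine Finset.sum_congr rfl fun i _ => ?_
  rw [h, smul_smul]
  congr 1
  linear_combination (2 * e.repr v i) * he.sq_eq_one i

theorem eq_zero_of_polar_eq_zero {v : V} (h : ∀ w, QuadraticMap.polar Q w v = 0) : v = 0 := by
  have h1 := he.sum_polar_smul v
  simp only [h, mul_zero, zero_smul, Finset.sum_const_zero] at h1
  exact (smul_eq_zero_iff_right (two_ne_zero (α := ℝ))).1 h1.symm

/-- The tensor `∑ Q(eᵢ) eᵢ ⊗ eᵢ` is multiplied by `ω` under a similarity of factor `ω`. -/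
theorem sum_similarity {M : Type*} [AddCommGroup M] [Module ℝ M] (β : V →ₗ[ℝ] V →ₗ[ℝ] M)
    (φ : V →ₗ[ℝ] V) {ω : ℝ} (hω : ω ≠ 0)
    (hφ : ∀ v w, QuadraticMap.polar Q (φ v) (φ w) = ω * QuadraticMap.polar Q v w) :
    ∑ i, Q (e i) • β (φ (e i)) (φ (e i)) = ω • ∑ i, Q (e i) • β (e i) (e i) := by
  have : FiniteDimensional ℝ V := Module.Basis.finiteDimensional_of_finite e
  have hinj : Function.Injective φ := by
    rw [injective_iff_map_eq_zero]
    intro v hv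
    refine he.eq_zero_of_polar_eq_zero fun w => ?_
    have h1 := hφ w v
    rw [hv, QuadraticMap.polar_zero_right, zero_eq_mul] at h1
    exact h1.resolve_left hω
  have hsurj := LinearMap.injective_iff_surjective.1 hinj
  -- The basis expansion transported by φ. Expanding one argument of β in the basis and exchanging
  -- the sums then collapses the inner sum.
  have h2 : ∀ j, ∑ i, (Q (e i) * QuadraticMap.polar Q (e j) (φ (e i))) • φ (e i) =
      (2 * ω) • e j := fun j => by
    obtain ⟨t, ht⟩ := hsurj (e j)
    have h3 := congrArg (fun v => ω • φ v) (he.sum_polar_smul t)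
    simp only [map_sum, map_smul, Finset.smul_sum, smul_smul, ht] at h3
    rw [mul_comm 2 ω, ← h3]
    refine Finset.sum_congr rfl fun i _ => ?_
    rw [← ht, hφ, QuadraticMap.polar_comm]
    congr 1
    ring
  apply smul_right_injective _ (two_ne_zero (α := ℝ))
  change (2 : ℝ) • _ = (2 : ℝ) • _
  calc (2 : ℝ) • ∑ i, Q (e i) • β (φ (e i)) (φ (e i))
      = ∑ i, Q (e i) • β ((2 : ℝ) • φ (e i)) (φ (e i)) := by
        simp only [Finset.smul_sum, map_smul, LinearMap.smul_apply]
        exact Finset.sum_congr rfl fun i _ => smul_comm _ _ _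
    _ = ∑ i, ∑ j, (Q (e i) * (Q (e j) * QuadraticMap.polar Q (e j) (φ (e i)))) •
          β (e j) (φ (e i)) := by
        refine Finset.sum_congr rfl fun i _ => ?_
        rw [← he.sum_polar_smul (φ (e i)), map_sum, LinearMap.sum_apply, Finset.smul_sum]
        simp only [map_smul, LinearMap.smul_apply, smul_smul]
    _ = ∑ j, Q (e j) • β (e j)
          (∑ i, (Q (e i) * QuadraticMap.polar Q (e j) (φ (e i))) • φ (e i)) := by
        rw [Finset.sum_comm]
        refine Finset.sum_congr rfl fun j _ => ?_
        rw [map_sum, Finset.smul_sum]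
        refine Finset.sum_congr rfl fun i _ => ?_
        rw [map_smul, smul_smul]
        congr 1
        ring
    _ = (2 : ℝ) • ω • ∑ i, Q (e i) • β (e i) (e i) := by
        simp only [h2, map_smul, Finset.smul_sum, smul_smul]
        refine Finset.sum_congr rfl fun i _ => ?_
        congr 1
        ring

theorem sum_vec_mul_self : ∑ i, Q (e i) • (vec Q (e i) * vec Q (e i)) =
    algebraMap ℝ (Cl Q) (-(Module.finrank ℝ V)) := by
  rw [Module.finrank_eq_card_basis e]
  simp only [vec_mul_self, Algebra.smul_def, ← map_mul, mul_neg, he.sq_eq_one, ← map_sum]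
  simp

end IsPseudoOrthonormal

end Orthonormal

/-! ### Derivatives of the norm and of the Möbius map. -/

section Calculus

/-- Euler's relation for a function homogeneous of degree -s, on either side of 0. -/
theorem hasDerivAt_abs_rpow_inv_mul_inv (s : ℝ) {t : ℝ} (ht : t ≠ 0) :
    HasDerivAt (fun t : ℝ => (|t| ^ (s - 1))⁻¹ * t⁻¹) (-s * ((|t| ^ (s - 1))⁻¹ * t⁻¹) / t) t := by
  have ha : 0 < |t| := abs_pos.2 ht
  have h1 := (((hasDerivAt_abs ht).rpow_const (p := s - 1) (Or.inl ha.ne')).inv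
    (Real.rpow_pos_of_pos ha _).ne').mul (hasDerivAt_inv ht)
  refine h1.congr_deriv ?_
  have h2 : |t| ^ (s - 1 - 1) = |t| ^ (s - 1) / |t| := Real.rpow_sub_one ha.ne' _
  have h3 : (SignType.sign t : ℝ) = t / |t| := by
    rw [eq_div_iff ha.ne', mul_comm]
    exact (abs_mul_sign t)
  have h4 : |t| ^ 2 = t ^ 2 := sq_abs t
  have h5 := (Real.rpow_pos_of_pos ha (s - 1)).ne'
  rw [h2, h3]
  simp only [Pi.inv_apply]
  field_simp
  rw [h4]
  field_simp
  ring

variable {V : Type*} [NormedAddCommGroup V] [NormedSpace ℝ V] [FiniteDimensional ℝ V]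
  {Q : QuadraticForm ℝ V}

/-- The Clifford algebra carries no norm here, so products in it are differentiated only after a
linear map into a normed space; the bilinear part is continuous because V is finite-dimensional. -/
theorem hasFDerivAt_affine_mul_affine {F : Type*} [NormedAddCommGroup F] [NormedSpace ℝ F]
    (T : Cl Q →ₗ[ℝ] F) (L₁ L₂ : V →ₗ[ℝ] Cl Q) (k₁ k₂ : Cl Q) (x : V) :
    ∃ D : V →L[ℝ] F, HasFDerivAt (fun y => T ((L₁ y + k₁) * (L₂ y + k₂))) D x ∧
      ∀ h, D h = T (L₁ h * (L₂ x + k₂) + (L₁ x + k₁) * L₂ h) := by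
  let B : V →L[ℝ] V →L[ℝ] F :=
    (((LinearMap.mul ℝ (Cl Q)).compl₁₂ L₁ L₂).compr₂ T).toContinuousBilinearMap
  let ℓ : V →L[ℝ] F := LinearMap.toContinuousLinearMap
    (T ∘ₗ ((LinearMap.mulRight ℝ k₂) ∘ₗ L₁ + (LinearMap.mulLeft ℝ k₁) ∘ₗ L₂))
  have hB : ∀ v w, B v w = T (L₁ v * L₂ w) := fun _ _ => rfl
  have hℓ : ∀ v, ℓ v = T (L₁ v * k₂ + k₁ * L₂ v) := fun _ => rfl
  refine ⟨_, ((((B.hasFDerivAt (x := x)).clm_apply (hasFDerivAt_id x)).add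
    (ℓ.hasFDerivAt (x := x))).add_const (T (k₁ * k₂))).congr_of_eventuallyEq
    (Filter.Eventually.of_forall fun y => ?_), fun h => ?_⟩
  · simp only [Pi.add_apply, id_eq, hB, hℓ, ← map_add]
    congr 1
    noncomm_ring
  · simp only [add_apply, ContinuousLinearMap.comp_apply,
      ContinuousLinearMap.flip_apply, ContinuousLinearMap.coe_id', id_eq, hB, hℓ, ← map_add]
    congr 1
    noncomm_ring

variable {A : Matrix (Fin 2) (Fin 2) (Cl Q)} {r κ δ : ℝ} {g : V}

namespace VahlenIdentities

variable (H : VahlenIdentities A r κ δ g)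
include H

theorem exists_hasFDerivAt_nrm (x : V) :
    ∃ D : V →L[ℝ] ℝ, HasFDerivAt (nrm A) D x ∧
      ∀ h, D h = -QuadraticMap.polar Q h (κ • x + g) := by
  obtain ⟨τ, hτ⟩ := LinearMap.exists_leftInverse_of_injective
    (Algebra.linearMap ℝ (Cl Q)) (LinearMap.ker_eq_bot.2 (algebraMap_injective (-Q)))
  have hτ' : ∀ t : ℝ, τ (algebraMap ℝ (Cl Q) t) = t := fun t => LinearMap.congr_fun hτ t
  obtain ⟨D, hD, hD'⟩ := hasFDerivAt_affine_mul_affine τ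
    ((LinearMap.mulRight ℝ (reverse (A 1 0))) ∘ₗ vec Q) ((LinearMap.mulLeft ℝ (A 1 0)) ∘ₗ vec Q)
    (reverse (A 1 1)) (A 1 1) x
  refine ⟨D, hD.congr_of_eventuallyEq (Filter.Eventually.of_forall fun y => ?_), fun h => ?_⟩
  · rw [← hτ' (nrm A y), H.algebraMap_nrm]; rfl
  · rw [hD', ← hτ' (-_), ← vec_mul_vec_add_swap]
    congr 1
    nth_rewrite 1 [← H.rev_c_mul_den]
    rw [← H.denRev_mul_c]
    simp only [LinearMap.comp_apply, LinearMap.mulRight_apply, LinearMap.mulLeft_apply, den,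
      denRev, mul_assoc]

theorem exists_hasFDerivAt_act {x : V} (hx : nrm A x ≠ 0) :
    ∃ D : V →L[ℝ] V, HasFDerivAt (act A) D x ∧
      ∀ h, vec Q (D h) = (r / nrm A x ^ 2) • (den A x * vec Q h * denRev A x) := by
  obtain ⟨π, hπ⟩ := LinearMap.exists_leftInverse_of_injective
    (vec Q) (LinearMap.ker_eq_bot.2 (ι_injective (-Q)))
  have hπ' : ∀ v, π (vec Q v) = v := fun v => LinearMap.congr_fun hπ v
  obtain ⟨W, hW, hW'⟩ := hasFDerivAt_affine_mul_affine π ((LinearMap.mulLeft ℝ (A 0 0)) ∘ₗ vec Q)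
    ((LinearMap.mulRight ℝ (reverse (A 1 0))) ∘ₗ vec Q) (A 0 1) (reverse (A 1 1)) x
  obtain ⟨D, hD, hD'⟩ := H.exists_hasFDerivAt_nrm x
  have hact : ∀ y, act A y = (nrm A y)⁻¹ • π ((A 0 0 * vec Q y + A 0 1) * denRev A y) := by
    intro y
    rw [← hπ' (act A y), H.vec_act, actCl, H.inverse_den, mul_smul_comm, map_smul]
  -- The projection π loses nothing, because the derivative of the numerator is itself a vector.
  have hvW : ∀ h, vec Q (W h) = A 0 0 * vec Q h * denRev A x +
      (A 0 0 * vec Q x + A 0 1) * (vec Q h * reverse (A 1 0)) := fun h => by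
    obtain ⟨w, hw⟩ := H.num_polarization x h
    rw [hw, hW', ← hπ' w, ← hw]
    rfl
  have hder := ((hasDerivAt_inv hx).comp_hasFDerivAt x hD).smul hW
  refine ⟨_, hder.congr_of_eventuallyEq (Filter.Eventually.of_forall hact), fun h => ?_⟩
  have hπx : π ((A 0 0 * vec Q x + A 0 1) * denRev A x) = nrm A x • act A x := by
    rw [hact, smul_inv_smul₀ hx]
  -- Substituting ax + b = y(cx + d) and differentiating N as (cx + d)(xc̃ + d̃) cancels the terms
  -- containing hc̃.
  have e1 : vec Q (W h) - D h • vec Q (act A x) =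
      (A 0 0 - vec Q (act A x) * A 1 0) * vec Q h * denRev A x := by
    rw [hvW, hD', ← H.vec_act_mul_den hx, Algebra.smul_def, Algebra.commutes,
      ← H.den_polarization hx]
    noncomm_ring
  calc _ = (nrm A x)⁻¹ • vec Q (W h) +
        (-((nrm A x ^ 2)⁻¹) * D h) • nrm A x • vec Q (act A x) := by
        rw [← map_smul (vec Q) (nrm A x), ← hπx, ← map_smul (vec Q), ← map_smul (vec Q),
          ← map_add (vec Q)]
        rfl
    _ = (nrm A x)⁻¹ • (vec Q (W h) - D h • vec Q (act A x)) := by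
        rw [smul_sub, smul_smul, smul_smul, sub_eq_add_neg, ← neg_smul]
        congr 2
        field_simp
    _ = (nrm A x ^ 2)⁻¹ • ((nrm A x • (A 0 0 - vec Q (act A x) * A 1 0)) *
          vec Q h * denRev A x) := by
        rw [e1, smul_mul_assoc, smul_mul_assoc, smul_smul]
        congr 1
        field_simp
    _ = _ := by
        rw [H.sub_act_mul hx, smul_mul_assoc, smul_mul_assoc, smul_smul, inv_mul_eq_div]

theorem isOpen_preimage {U : Set V} (hU : IsOpen U) : IsOpen (preimage A U) := by
  rw [H.preimage_eq]
  have hc : Continuous (nrm A) := continuous_iff_continuousAt.2 fun x =>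
    (H.exists_hasFDerivAt_nrm x).choose_spec.1.continuousAt
  refine ContinuousOn.isOpen_inter_preimage (fun x hx => ?_)
    (isOpen_ne.preimage hc) hU
  exact (H.exists_hasFDerivAt_act hx).choose_spec.1.continuousAt.continuousWithinAt

end VahlenIdentities

end Calculus

/-! ### Covariance of the left Dirac operator. -/

section Dirac

variable {V : Type*} [NormedAddCommGroup V] [NormedSpace ℝ V]
  {Q : QuadraticForm ℝ V} {p q : ℕ} {e : Module.Basis (Fin p ⊕ Fin q) ℝ V}
  (he : IsPseudoOrthonormal Q e)
  {M : Type*} [NormedAddCommGroup M] [NormedSpace ℝ M] [Module (Cl Q) M]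

include he in
theorem IsPseudoOrthonormal.diracL_eq_sum {f : V → M} {x : V} {D : V →L[ℝ] M}
    (hf : HasFDerivAt f D x) : diracL Q e f x = ∑ i, Q (e i) • vec Q (e i) • D (e i) := by
  rw [diracL, hf.fderiv, Fintype.sum_sum_type]
  simp [he.pos, he.neg, sub_eq_add_neg]

variable [IsScalarTower ℝ (Cl Q) M] [ContinuousConstSMul (Cl Q) M]

/-- The action of the Clifford algebra on a module by continuous linear maps. -/
def smulCLM (Q : QuadraticForm ℝ V) (M : Type*) [NormedAddCommGroup M] [NormedSpace ℝ M]
    [Module (Cl Q) M] [IsScalarTower ℝ (Cl Q) M] [ContinuousConstSMul (Cl Q) M] :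
    Cl Q →ₗ[ℝ] M →L[ℝ] M where
  toFun a :=
    { toFun := fun m => a • m
      map_add' := smul_add a
      map_smul' := fun t m => by
        rw [RingHom.id_apply, ← algebraMap_smul (Cl Q) t m, ← algebraMap_smul (Cl Q) t (a • m),
          smul_smul, smul_smul, Algebra.commutes]
      cont := continuous_const_smul a }
  map_add' a b := by ext m; exact add_smul a b m
  map_smul' t a := by ext m; exact smul_assoc t a m

@[simp]
theorem smulCLM_apply (a : Cl Q) (m : M) : smulCLM Q M a m = a • m := rfl

theorem smul_smul_comm_real (t : ℝ) (a : Cl Q) (m : M) : a • t • m = t • a • m :=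
  map_smul (smulCLM Q M a) t m

variable {A : Matrix (Fin 2) (Fin 2) (Cl Q)} {r κ δ : ℝ} {g : V}

include he in
/-- Conformal covariance of the left Dirac operator at a point. -/
theorem VahlenIdentities.diracL_J_smul (H : VahlenIdentities A r κ δ g) {f : V → M} {x : V}
    (hx : nrm A x ≠ 0) (hf : DifferentiableAt ℝ f (act A x)) :
    DifferentiableAt ℝ (fun y => J A y • f (act A y)) x ∧
      diracL Q e (fun y => J A y • f (act A y)) x =
        Omega A x • J A x • diracL Q e f (act A x) := by
  have : FiniteDimensional ℝ V := Module.Basis.finiteDimensional_of_finite e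
  obtain ⟨N, hN, hN'⟩ := H.exists_hasFDerivAt_nrm x
  obtain ⟨φ, hφ, hφ'⟩ := H.exists_hasFDerivAt_act hx
  set s : ℝ := (Module.finrank ℝ V : ℝ) / 2 with hs
  set σ : ℝ := (|nrm A x| ^ (s - 1))⁻¹ * (nrm A x)⁻¹ with hσ
  set D := fderiv ℝ f (act A x) with hD
  let L : V →L[ℝ] M →L[ℝ] M := LinearMap.toContinuousLinearMap
    (smulCLM Q M ∘ₗ LinearMap.mulRight ℝ (reverse (A 1 0)) ∘ₗ vec Q)
  have hL : ∀ h, L h = smulCLM Q M (vec Q h * reverse (A 1 0)) := fun _ => rfl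
  have hden : HasFDerivAt (fun y => smulCLM Q M (denRev A y)) L x := by
    refine ((L.hasFDerivAt (x := x)).add_const (smulCLM Q M (reverse (A 1 1)))).congr_of_eventuallyEq
      (Filter.Eventually.of_forall fun y => ?_)
    simp only [hL, denRev, map_add]
  have hJ : ∀ y, J A y • f (act A y) = ((|nrm A y| ^ (s - 1))⁻¹ * (nrm A y)⁻¹) •
      smulCLM Q M (denRev A y) (f (act A y)) := fun y => by
    rw [H.J_eq, smul_assoc, smulCLM_apply]
  have hder := (((hasDerivAt_abs_rpow_inv_mul_inv s hx).comp_hasFDerivAt x hN).smul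
    (hden.clm_apply (hf.hasFDerivAt.comp x hφ))).congr_of_eventuallyEq
      (Filter.Eventually.of_forall hJ)
  refine ⟨hder.differentiableAt, ?_⟩
  rw [he.diracL_eq_sum hder, he.diracL_eq_sum hf.hasFDerivAt]
  set F := f (act A x) with hF
  have hterm : ∀ h, (((fun t : ℝ => (|t| ^ (s - 1))⁻¹ * t⁻¹) ∘ nrm A) x •
      ((smulCLM Q M (denRev A x)).comp (D.comp φ) + L.flip F) +
      ((-s * ((|nrm A x| ^ (s - 1))⁻¹ * (nrm A x)⁻¹) / nrm A x) • N).smulRight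
        (smulCLM Q M (denRev A x) F)) h =
      σ • denRev A x • D (φ h) + σ • (vec Q h * reverse (A 1 0)) • F +
        (s * σ / nrm A x * QuadraticMap.polar Q h (κ • x + g)) • denRev A x • F := fun h => by
    have e1 : ((fun t : ℝ => (|t| ^ (s - 1))⁻¹ * t⁻¹) ∘ nrm A) x = σ := rfl
    rw [e1, ← hσ]
    simp only [add_apply, smul_apply, ContinuousLinearMap.comp_apply,
      ContinuousLinearMap.flip_apply, ContinuousLinearMap.smulRight_apply, hL, smulCLM_apply, hN',
      smul_add]
    congr 2
    rw [smul_eq_mul]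
    ring
  -- The scalar factor contributes its gradient, a multiple of v = κx + g, and v(xc̃ + d̃) = c̃(cx +
  -- d)(xc̃ + d̃) = Nc̃.
  have hG : ∑ i, Q (e i) • vec Q (e i) •
      ((s * σ / nrm A x * QuadraticMap.polar Q (e i) (κ • x + g)) • denRev A x • F) =
      (2 * s * σ) • reverse (A 1 0) • F := by
    have h1 := congrArg (fun v => (s * σ / nrm A x) • vec Q v • denRev A x • F)
      (he.sum_polar_smul (κ • x + g))
    simp only [map_sum, map_smul, Finset.sum_smul, Finset.smul_sum] at h1
    calc _ = _ := Finset.sum_congr rfl fun i _ => ?_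
      _ = _ := h1
      _ = _ := ?_
    · rw [smul_smul_comm_real, smul_assoc (Q (e i) * _), smul_smul (Q (e i)),
        smul_smul (s * σ / nrm A x)]
      congr 1
      ring
    · rw [smul_assoc (2 : ℝ), smul_smul _ _ F, ← H.rev_c_mul_den, mul_assoc,
        H.den_mul_denRev_eq hx, ← Algebra.commutes, ← Algebra.smul_def, smul_assoc, smul_smul,
        smul_smul]
      congr 1
      field_simp
  have hV : ∑ i, Q (e i) • vec Q (e i) • (σ • (vec Q (e i) * reverse (A 1 0)) • F) =
      -((2 * s * σ) • reverse (A 1 0) • F) := by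
    have h1 := congrArg (fun a => σ • (a * reverse (A 1 0)) • F) he.sum_vec_mul_self
    simp only [Finset.sum_mul, Finset.sum_smul, Finset.smul_sum] at h1
    calc _ = _ := Finset.sum_congr rfl fun i _ => ?_
      _ = _ := h1
      _ = _ := ?_
    · rw [smul_smul_comm_real σ, smul_smul (vec Q _), smul_mul_assoc, smul_assoc (Q (e i)),
        mul_assoc, smul_comm (Q (e i)) σ]
    · rw [← Algebra.smul_def, smul_assoc, smul_smul, ← neg_smul]
      congr 1
      rw [hs]
      ring
  have hΩ : Omega A x ≠ 0 := by
    rw [Omega, H.pdet_eq]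
    exact div_ne_zero H.ne_zero hx
  have hT : ∑ i, Q (e i) • vec Q (e i) • (σ • denRev A x • D (φ (e i))) =
      Omega A x • J A x • ∑ i, Q (e i) • vec Q (e i) • D (e i) := by
    -- The Dirac operator at y is the contraction of this bilinear map with ∑ Q(eᵢ) eᵢ ⊗ eᵢ.
    let β : V →ₗ[ℝ] V →ₗ[ℝ] M := LinearMap.mk₂ ℝ (fun v w => vec Q v • D w)
      (fun v v' w => by rw [map_add, add_smul]) (fun t v w => by rw [map_smul, smul_assoc])
      (fun v w w' => by rw [map_add, smul_add])
      (fun t v w => by rw [map_smul, smul_smul_comm_real])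
    have hβ := he.sum_similarity β φ.toLinearMap (pow_ne_zero 2 hΩ)
      (H.polar_of_vec_eq hx hφ')
    have h1 := congrArg (fun m => (σ * (Omega A x)⁻¹) • denRev A x • m) hβ
    simp only [Finset.smul_sum (r := denRev A x), Finset.smul_sum (r := σ * _)] at h1
    calc _ = _ := Finset.sum_congr rfl fun i _ => ?_
      _ = _ := h1
      _ = _ := ?_
    · change _ = (σ * (Omega A x)⁻¹) • denRev A x • Q (e i) •
        vec Q (φ (e i)) • D (φ (e i))
      rw [smul_smul_comm_real, smul_smul (vec Q _), H.vec_mul_denRev hx hφ', smul_assoc,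
        smul_smul_comm_real (Q (e i)), smul_smul (denRev A x)]
      simp only [smul_smul]
      congr 1
      ring
    · change (σ * (Omega A x)⁻¹) • denRev A x • Omega A x ^ 2 •
        ∑ i, Q (e i) • vec Q (e i) • D (e i) = _
      rw [H.J_eq, smul_assoc, smul_smul_comm_real, smul_smul, smul_smul, ← hσ]
      congr 1
      field_simp
  calc _ = ∑ i, Q (e i) • vec Q (e i) • (σ • denRev A x • D (φ (e i)) +
        σ • (vec Q (e i) * reverse (A 1 0)) • F +
        (s * σ / nrm A x * QuadraticMap.polar Q (e i) (κ • x + g)) • denRev A x • F) :=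
        Finset.sum_congr rfl fun i _ =>
          congrArg (fun m => Q (e i) • vec Q (e i) • m) (hterm (e i))
    _ = _ := by
      simp only [smul_add, Finset.sum_add_distrib]
      rw [hT, hV, hG, neg_add_cancel_right]

end Dirac

/-! ### Right modules by reversal, and the main theorem. -/

theorem reverse_inverse {V : Type*} [AddCommGroup V] [Module ℝ V] {Q : QuadraticForm ℝ V}
    (a : Cl Q) : reverse (Ring.inverse a) = Ring.inverse (reverse a) := by
  by_cases ha : IsUnit a
  · have ha' := isUnit_reverse ha
    apply ha'.mul_right_cancel
    rw [Ring.inverse_mul_cancel _ ha', ← reverse.map_mul, Ring.mul_inverse_cancel _ ha,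
      reverse.map_one]
  · have ha' : ¬IsUnit (reverse a) := fun h => ha (by simpa using isUnit_reverse h)
    rw [Ring.inverse_non_unit _ ha, Ring.inverse_non_unit _ ha', map_zero]

theorem reverse_J {V : Type*} [AddCommGroup V] [Module ℝ V] {Q : QuadraticForm ℝ V}
    (A : Matrix (Fin 2) (Fin 2) (Cl Q)) (x : V) : reverse (J A x) = JRev A x := by
  rw [J, JRev, map_smul, reverse_inverse, reverse_den]

section Dirac

variable {V : Type*} [NormedAddCommGroup V] [NormedSpace ℝ V]
  {Q : QuadraticForm ℝ V} {p q : ℕ} {e : Module.Basis (Fin p ⊕ Fin q) ℝ V}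
  {A : Matrix (Fin 2) (Fin 2) (Cl Q)} {r κ δ : ℝ} {g : V}

/-- Conformal covariance of the right Dirac operator at a point. -/
theorem VahlenIdentities.diracR_JRev_smul (H : VahlenIdentities A r κ δ g)
    (he : IsPseudoOrthonormal Q e)
    {M : Type*} [NormedAddCommGroup M] [NormedSpace ℝ M] [Module (Cl Q)ᵐᵒᵖ M]
    [IsScalarTower ℝ (Cl Q)ᵐᵒᵖ M] [ContinuousConstSMul (Cl Q)ᵐᵒᵖ M] {f : V → M} {x : V}
    (hx : nrm A x ≠ 0) (hf : DifferentiableAt ℝ f (act A x)) :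
    DifferentiableAt ℝ (fun y => MulOpposite.op (JRev A y) • f (act A y)) x ∧
      diracR Q e (fun y => MulOpposite.op (JRev A y) • f (act A y)) x =
        Omega A x • MulOpposite.op (JRev A x) • diracR Q e f (act A x) := by
  -- Reversal makes the right module a left one. It fixes vectors and exchanges `J` with `JRev`, so
  -- the two Dirac operators coincide and the left-handed result applies.
  let _ : Module (Cl Q) M :=
    Module.compHom M (reverseOp : Cl Q →ₐ[ℝ] (Cl Q)ᵐᵒᵖ).toRingHom
  have hsmul : ∀ (a : Cl Q) (m : M), a • m = MulOpposite.op (reverse a) • m := fun _ _ => rfl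
  have : IsScalarTower ℝ (Cl Q) M := ⟨fun t a m => by
    rw [hsmul, hsmul, map_smul, MulOpposite.op_smul, smul_assoc]⟩
  have : ContinuousConstSMul (Cl Q) M :=
    ⟨fun a => continuous_const_smul (MulOpposite.op (reverse a))⟩
  have hdirac : ∀ (f : V → M) (y : V), diracR Q e f y = diracL Q e f y := fun f y => by
    simp only [diracR, diracL, hsmul, reverse_ι]
  have key := H.diracL_J_smul he hx hf
  simpa only [hsmul, reverse_J, ← hdirac] using key

end Dirac

end Vahlen

theorem mainTheorem1 {V : Type*} [NormedAddCommGroup V] [NormedSpace ℝ V]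
    (Q : QuadraticForm ℝ V) {p q : ℕ} (e : Module.Basis (Fin p ⊕ Fin q) ℝ V)
    (he : Vahlen.IsPseudoOrthonormal Q e)
    {M : Type*} [NormedAddCommGroup M] [NormedSpace ℝ M] [Module (Vahlen.Cl Q) M]
    [IsScalarTower ℝ (Vahlen.Cl Q) M] [ContinuousConstSMul (Vahlen.Cl Q) M]
    {M' : Type*} [NormedAddCommGroup M'] [NormedSpace ℝ M'] [Module (Vahlen.Cl Q)ᵐᵒᵖ M']
    [IsScalarTower ℝ (Vahlen.Cl Q)ᵐᵒᵖ M'] [ContinuousConstSMul (Vahlen.Cl Q)ᵐᵒᵖ M']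
    (A : Matrix (Fin 2) (Fin 2) (Vahlen.Cl Q)) (hA : Vahlen.IsVahlen A) :
    -- the quantities in the formulas are what they are meant to be
    (algebraMap ℝ (Vahlen.Cl Q) (Vahlen.pdet A) = Vahlen.pdetCl A ∧ Vahlen.pdet A ≠ 0) ∧
    (∀ x : V, IsUnit (Vahlen.den A x) →
      Vahlen.vec Q (Vahlen.act A x) = Vahlen.actCl A x ∧
      algebraMap ℝ (Vahlen.Cl Q) (Vahlen.nrm A x) = Vahlen.denRev A x * Vahlen.den A x ∧
      Vahlen.nrm A x ≠ 0) ∧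
    -- left modules
    (∀ (U : Set V) (f : V → M), IsOpen U → DifferentiableOn ℝ f U →
      (∀ x ∈ Vahlen.preimage A U,
        DifferentiableAt ℝ (fun y => Vahlen.J A y • f (Vahlen.act A y)) x ∧
        Vahlen.diracL Q e (fun y => Vahlen.J A y • f (Vahlen.act A y)) x =
          Vahlen.Omega A x • Vahlen.J A x • Vahlen.diracL Q e f (Vahlen.act A x)) ∧
      (Vahlen.IsLeftMonogenicOn Q e f U →
        Vahlen.IsLeftMonogenicOn Q e (fun y => Vahlen.J A y • f (Vahlen.act A y))
          (Vahlen.preimage A U))) ∧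
    -- right modules
    (∀ (U : Set V) (g : V → M'), IsOpen U → DifferentiableOn ℝ g U →
      (∀ x ∈ Vahlen.preimage A U,
        DifferentiableAt ℝ
          (fun y => MulOpposite.op (Vahlen.JRev A y) • g (Vahlen.act A y)) x ∧
        Vahlen.diracR Q e
            (fun y => MulOpposite.op (Vahlen.JRev A y) • g (Vahlen.act A y)) x =
          Vahlen.Omega A x •
            MulOpposite.op (Vahlen.JRev A x) • Vahlen.diracR Q e g (Vahlen.act A x)) ∧
      (Vahlen.IsRightMonogenicOn Q e g U →
        Vahlen.IsRightMonogenicOn Q e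
          (fun y => MulOpposite.op (Vahlen.JRev A y) • g (Vahlen.act A y))
          (Vahlen.preimage A U))) := by
  obtain ⟨r, κ, δ, g, H⟩ := hA.exists_identities he
  refine ⟨⟨by rw [H.pdet_eq, H.pdetCl_eq], by rw [H.pdet_eq]; exact H.ne_zero⟩,
    fun x hx => ⟨H.vec_act x, H.algebraMap_nrm x, H.nrm_ne_zero hx⟩,
    fun U f hU hf => ?_, fun U f hU hf => ?_⟩
  · have h1 := fun x (hx : x ∈ Vahlen.preimage A U) => H.diracL_J_smul he (H.nrm_ne_zero hx.1)
      (hf.differentiableAt (hU.mem_nhds hx.2))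
    refine ⟨h1, fun hm => ⟨haveI := Module.Basis.finiteDimensional_of_finite e
      H.isOpen_preimage hU, fun x hx => (h1 x hx).1, fun x hx => ?_⟩⟩
    rw [(h1 x hx).2, hm.dirac_eq_zero _ hx.2, smul_zero, smul_zero]
  · have h1 := fun x (hx : x ∈ Vahlen.preimage A U) => H.diracR_JRev_smul he
      (H.nrm_ne_zero hx.1) (hf.differentiableAt (hU.mem_nhds hx.2))
    refine ⟨h1, fun hm => ⟨haveI := Module.Basis.finiteDimensional_of_finite e
      H.isOpen_preimage hU, fun x hx => (h1 x hx).1, fun x hx => ?_⟩⟩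
    rw [(h1 x hx).2, hm.dirac_eq_zero _ hx.2, smul_zero, smul_zero]
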